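/- Let $0<\alpha\le 2$, let $\theta\in\mathbb{R}$ satisfy $|\theta|\le\min(\pi\alpha/2,\ \pi-\pi\alpha/2)$, let $\lambda>0$, and let $k\ge 1$ be an integer. Let $\mu$ be the generalized Linnik law $\mathrm{GL}(\alpha,\theta,1/k)$ with scale constant $\lambda$, that is, a probability measure on $\mathbb{R}$ with characteristic function $$\int_{\mathbb{R}} e^{iux}\,\mu(dx)=\frac{1}{\bigl[1+\lambda|u|^{\alpha}e^{-i\theta\,\mathrm{sgn}(u)}\bigr]^{1/k}}\qquad(u\in\mathbb{R}),$$ where the power is the principal one. Then $\mu$ is absolutely continuous with respect to Lebesgue measure on $\mathbb{R}$. -/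

import Mathlib

open MeasureTheory

/-- The function `u ↦ 1 / [1 + lam |u| ^ α exp (-i θ sgn u)] ^ ν` on the real line. The complex power
is the principal one; for `|θ| ≤ π / 2` and `0 ≤ lam` its base has real part at least `1`, so it is
the branch that is continuous in `u` and equal to `1` at `u = 0`. -/
noncomputable def linnikCF (α θ lam ν : ℝ) (u : ℝ) : ℂ :=
  1 / (1 + (lam : ℂ) * ((|u| ^ α : ℝ) : ℂ) *
    Complex.exp (-Complex.I * (θ : ℂ) * ((Real.sign u : ℝ) : ℂ))) ^ (ν : ℂ)

/-- `μ` is the generalized Linnik law `GL(α, θ, ν)` with scale constant `lam`: the probability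
measure on the real line whose characteristic function is `linnikCF α θ lam ν`. -/
structure IsGeneralizedLinnik (α θ lam ν : ℝ) (μ : Measure ℝ) : Prop where
  isProbabilityMeasure : IsProbabilityMeasure μ
  charFun_eq : ∀ u : ℝ, charFun μ u = linnikCF α θ lam ν u

/-! The characteristic function `φ` need not be integrable, so Fourier inversion is not available,
but `φ'` is integrable. Up to a constant, `φ'` is the Fourier transform of the moment measure `x
μ(dx)`, so that measure is dominated by Lebesgue measure (`norm_integral_mul_schwartz_le`) and `μ`
has no singular part off `0`. An atom at `0` is excluded because `φ` tends to `0` at infinity. On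
each half-line `φ` is `(1 + c |u| ^ α) ^ (-ν)` with `0 ≤ c.re`, and `‖φ'‖` is at most a multiple of
the derivative of a bounded monotone function (`integrableOn_halfLinnikDeriv`). -/

/-! ### Fourier criterion for absolute continuity. -/

open Filter Topology FourierTransform SchwartzMap in
/-- Integration by parts on the line against a Schwartz function, for a bounded continuous
function that is differentiable away from the origin. -/
theorem integral_deriv_schwartz_mul_eq_neg (h : 𝓢(ℝ, ℂ)) {Φ Φ' : ℝ → ℂ} {B : ℝ}
    (hcont : Continuous Φ) (hbdd : ∀ u, ‖Φ u‖ ≤ B)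
    (hderiv : ∀ u, u ≠ 0 → HasDerivAt Φ (Φ' u) u) (hint : Integrable Φ') :
    ∫ u, deriv h u * Φ u = - ∫ u, h u * Φ' u := by
  have hd : ∀ u, HasDerivAt h (deriv h u) u := fun u => h.differentiableAt.hasDerivAt
  have i1 : Integrable (fun u => deriv h u * Φ u) :=
    ((derivCLM ℂ ℂ h).integrable (μ := volume)).mul_bdd
      hcont.aestronglyMeasurable (ae_of_all _ hbdd)
  obtain ⟨C, hC⟩ : ∃ C, ∀ u, ‖h u‖ ≤ C := by
    obtain ⟨C, hC⟩ := h.decay 0 0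
    exact ⟨C, fun u => by simpa using hC.2 u⟩
  have i2 : Integrable (fun u => h u * Φ' u) :=
    hint.bdd_mul h.continuous.aestronglyMeasurable (ae_of_all _ hC)
  have hz : Tendsto h (cocompact ℝ) (𝓝 0) := zero_at_infty h
  have hzp : Tendsto (fun u => h u * Φ u) (cocompact ℝ) (𝓝 0) := by
    refine squeeze_zero_norm (a := fun u => ‖h u‖ * B) (fun u => ?_) ?_
    · rw [norm_mul]; exact mul_le_mul_of_nonneg_left (hbdd u) (norm_nonneg _)
    · simpa using hz.norm.mul_const B
  have hc0 : Tendsto (fun u => h u * Φ u) (𝓝 0) (𝓝 (h 0 * Φ 0)) :=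
    (h.continuous.mul hcont).tendsto 0
  -- The line is cut at the possible singularity; the two boundary terms `h 0 * Φ 0` cancel.
  have e1 := integral_Ioi_mul_deriv_eq_deriv_mul (a := 0) (u := h) (v := Φ) (u' := deriv h)
    (v' := Φ') (fun x _ => hd x) (fun x hx => hderiv x (ne_of_gt hx)) i2.integrableOn
    i1.integrableOn (hc0.mono_left nhdsWithin_le_nhds) (hzp.mono_left atTop_le_cocompact)
  have e2 := integral_Iic_mul_deriv_eq_deriv_mul (a := 0) (u := h) (v := Φ) (u' := deriv h)
    (v' := Φ') (fun x _ => hd x) (fun x hx => hderiv x (ne_of_lt hx)) i2.integrableOn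
    i1.integrableOn (hc0.mono_left nhdsWithin_le_nhds) (hzp.mono_left atBot_le_cocompact)
  rw [← intervalIntegral.integral_Iic_add_Ioi i1.integrableOn i1.integrableOn (b := 0),
    ← intervalIntegral.integral_Iic_add_Ioi i2.integrableOn i2.integrableOn (b := 0), e1, e2]
  ring

open FourierTransform SchwartzMap in
/-- Parseval's identity between a Schwartz function and a finite measure. -/
theorem integral_fourier_schwartz_eq_integral_mul_charFun (μ : Measure ℝ) [IsFiniteMeasure μ]
    (h : 𝓢(ℝ, ℂ)) :
    ∫ x, 𝓕 (h : ℝ → ℂ) x ∂μ = ∫ u, h u * charFun μ (-(2 * Real.pi) * u) := by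
  have := VectorFourier.integral_fourierIntegral_smul_eq_flip (L := innerₗ ℝ) (μ := volume)
    (ν := μ) (f := h) (g := fun _ => (1 : ℂ)) Real.continuous_fourierChar
    continuous_inner h.integrable (integrable_const _)
  simp only [smul_eq_mul, mul_one, flip_innerₗ] at this
  refine this.trans (integral_congr_ae (ae_of_all _ fun u => ?_))
  simp only [charFun_eq_fourierIntegral']
  congr 2
  simp only [smul_eq_mul]
  field_simp

open FourierTransform SchwartzMap in
/-- If the characteristic function of `μ` has an integrable derivative away from the origin, then
the moment measure `x μ(dx)` is dominated by a multiple of Lebesgue measure. -/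
theorem norm_integral_mul_schwartz_le {μ : Measure ℝ} [IsProbabilityMeasure μ] {φ' : ℝ → ℂ}
    (hderiv : ∀ u, u ≠ 0 → HasDerivAt (charFun μ) (φ' u) u) (hint : Integrable φ')
    (F : 𝓢(ℝ, ℂ)) :
    ‖∫ x, (x : ℂ) * F x ∂μ‖ ≤ (∫ u, ‖φ' (-(2 * Real.pi) * u)‖) * ∫ x, ‖F x‖ := by
  have hpi := Real.pi_pos
  have hne : -(2 * Real.pi) ≠ 0 := by linarith
  set h : 𝓢(ℝ, ℂ) := 𝓕⁻ F with hh
  have hF : 𝓕 (h : ℝ → ℂ) = F := by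
    rw [← fourier_coe, hh, FourierTransform.fourier_fourierInv_eq]
  -- This sup bound by the `L¹` norm of `F` is what yields domination by Lebesgue measure.
  have hb : ∀ u, ‖h u‖ ≤ ∫ x, ‖F x‖ := fun u => by
    rw [hh, fourierInv_coe, Real.fourierInv_eq]
    refine (norm_integral_le_integral_norm _).trans_eq ?_
    simp
  have hcomp := (integrable_comp_mul_left_iff φ' hne).2 hint
  have hΦ' : Integrable (fun u => ((-(2 * Real.pi) : ℝ) : ℂ) * φ' (-(2 * Real.pi) * u)) :=
    hcomp.const_mul _
  have hibp := integral_deriv_schwartz_mul_eq_neg h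
    (Φ := fun u => charFun μ (-(2 * Real.pi) * u)) (B := 1)
    (by fun_prop) (fun u => norm_charFun_le_one _)
    (fun u hu => by
      have := (hderiv (-(2 * Real.pi) * u) (mul_ne_zero hne hu)).scomp u
        ((hasDerivAt_id u).const_mul (-(2 * Real.pi)))
      simpa [Function.comp_def] using this) hΦ'
  have hpars := integral_fourier_schwartz_eq_integral_mul_charFun μ (derivCLM ℂ ℂ h)
  simp only [derivCLM_apply] at hpars
  rw [hibp] at hpars
  have hfd : ∀ x, 𝓕 (derivCLM ℂ ℂ h : ℝ → ℂ) x = (2 * Real.pi * Complex.I) * ((x : ℂ) * F x) := by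
    intro x
    have := congrFun (Real.fourier_deriv h.integrable h.differentiable
      (derivCLM ℂ ℂ h).integrable) x
    rw [hF] at this
    rw [show (derivCLM ℂ ℂ h : ℝ → ℂ) = deriv h from funext fun u => derivCLM_apply ℂ h u, this]
    simp only [smul_eq_mul]
    ring
  simp only [hfd] at hpars
  rw [integral_const_mul] at hpars
  have hn := congrArg norm hpars
  rw [norm_mul, norm_neg] at hn
  have h2 : ‖(2 * Real.pi * Complex.I : ℂ)‖ = 2 * Real.pi := by
    simp [abs_of_pos hpi]
  rw [h2] at hn
  have hle : ‖∫ u, h u * (((-(2 * Real.pi) : ℝ) : ℂ) * φ' (-(2 * Real.pi) * u))‖ ≤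
      ∫ u, (∫ x, ‖F x‖) * ((2 * Real.pi) * ‖φ' (-(2 * Real.pi) * u)‖) := by
    refine norm_integral_le_of_norm_le ((hcomp.norm.const_mul _).const_mul _) (ae_of_all _ fun u => ?_)
    rw [norm_mul, norm_mul, Complex.norm_real, norm_neg, Real.norm_of_nonneg (by positivity)]
    exact mul_le_mul_of_nonneg_right (hb u) (by positivity)
  rw [integral_const_mul, integral_const_mul, ← hn] at hle
  refine le_of_mul_le_mul_left (hle.trans_eq ?_) (by positivity : 0 < 2 * Real.pi)
  ring

open Filter Topology in
/-- A finite measure whose characteristic function vanishes at infinity has no mass at `0`. -/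
theorem measure_singleton_zero_of_tendsto_charFun {μ : Measure ℝ} [IsProbabilityMeasure μ]
    (htop : Tendsto (charFun μ) atTop (𝓝 0)) (hbot : Tendsto (charFun μ) atBot (𝓝 0)) :
    μ {0} = 0 := by
  -- The mean of `exp (i u x)` over `|u| ≤ n + 1` is `sinc ((n + 1) x)`, which tends to the
  -- indicator of `{0}`; the same mean of `charFun μ` tends to `0`.
  have h1 : Tendsto (fun n : ℕ => ∫ x, Real.sinc ((n + 1 : ℝ) * x) ∂μ) atTop
      (𝓝 (∫ x, Set.indicator {0} (1 : ℝ → ℝ) x ∂μ)) := by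
    refine tendsto_integral_of_dominated_convergence (fun _ => 1)
      (fun n => (Real.continuous_sinc.comp (continuous_const_mul _)).aestronglyMeasurable)
      (integrable_const _)
      (fun n => ae_of_all _ fun x => by simpa using Real.abs_sinc_le_one _)
      (ae_of_all _ fun x => ?_)
    by_cases hx : x = 0
    · simp [hx]
    · simp only [Set.mem_singleton_iff, hx, not_false_eq_true, Set.indicator_of_notMem]
      refine squeeze_zero_norm (a := fun n : ℕ => (1 / ((n : ℝ) + 1)) * |x|⁻¹) (fun n => ?_) ?_
      · have hn : (0 : ℝ) < n + 1 := by positivity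
        rw [Real.sinc_of_ne_zero (mul_ne_zero hn.ne' hx), norm_div, Real.norm_eq_abs,
          Real.norm_eq_abs, abs_mul, abs_of_pos hn, one_div, ← mul_inv, ← one_div]
        exact div_le_div_of_nonneg_right (Real.abs_sin_le_one _) (by positivity)
      · simpa using tendsto_one_div_add_atTop_nhds_zero_nat.mul_const (|x|⁻¹)
  have h2 : Tendsto (fun n : ℕ => ∫ v in (-1 : ℝ)..1, charFun μ ((n + 1 : ℝ) * v)) atTop (𝓝 0) := by
    have := intervalIntegral.tendsto_integral_filter_of_dominated_convergence (μ := volume)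
      (a := (-1 : ℝ)) (b := 1) (l := atTop)
      (F := fun (n : ℕ) v => charFun μ ((n + 1 : ℝ) * v)) (f := fun _ => 0) (fun _ => 1)
      (Eventually.of_forall fun n => by
        have : Continuous fun v => charFun μ ((n + 1 : ℝ) * v) := by fun_prop
        exact this.aestronglyMeasurable)
      (Eventually.of_forall fun n => ae_of_all _ fun v _ => norm_charFun_le_one _)
      intervalIntegrable_const ?_
    · simpa using this
    · have h0 : ∀ᵐ v : ℝ, v ≠ 0 := by simp [ae_iff]
      have hN : Tendsto (fun n : ℕ => (n : ℝ) + 1) atTop atTop :=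
        tendsto_atTop_add_const_right _ _ tendsto_natCast_atTop_atTop
      filter_upwards [h0] with v hv _
      rcases lt_or_gt_of_ne hv with hv | hv
      · exact hbot.comp (hN.atTop_mul_const_of_neg hv)
      · exact htop.comp (hN.atTop_mul_const hv)
  have h3 : ∀ n : ℕ, ∫ v in (-1 : ℝ)..1, charFun μ ((n + 1 : ℝ) * v) =
      ((2 * ∫ x, Real.sinc ((n + 1 : ℝ) * x) ∂μ : ℝ) : ℂ) := by
    intro n
    have hn : (0 : ℝ) < n + 1 := by positivity
    have hn' : ((n : ℂ) + 1) ≠ 0 := by exact_mod_cast hn.ne'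
    rw [intervalIntegral.integral_comp_mul_left _ hn.ne']
    simp only [mul_neg, mul_one]
    rw [integral_charFun_Icc hn]
    simp only [Complex.real_smul]
    push_cast
    field_simp
  simp only [h3] at h2
  have h4 := tendsto_nhds_unique h2 ((Complex.continuous_ofReal.tendsto _).comp (h1.const_mul 2))
  rw [integral_indicator_one (measurableSet_singleton 0)] at h4
  have h5 : μ.real {0} = 0 := by
    have := Complex.ofReal_eq_zero.1 h4.symm
    linarith
  simpa [measureReal_eq_zero_iff] using h5

open Filter Topology Manifold ContDiff in
/-- A probability measure on the line whose characteristic function vanishes at infinity and has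
an integrable derivative away from the origin is absolutely continuous. -/
theorem absolutelyContinuous_of_integrable_deriv_charFun {μ : Measure ℝ} [IsProbabilityMeasure μ]
    {φ' : ℝ → ℂ} (hderiv : ∀ u, u ≠ 0 → HasDerivAt (charFun μ) (φ' u) u) (hint : Integrable φ')
    (htop : Tendsto (charFun μ) atTop (𝓝 0)) (hbot : Tendsto (charFun μ) atBot (𝓝 0)) :
    μ ≪ volume := by
  set C : ℝ := ∫ u, ‖φ' (-(2 * Real.pi) * u)‖ with hCdef
  have hC : 0 ≤ C := integral_nonneg fun _ => norm_nonneg _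
  have key : ∀ K : Set ℝ, IsCompact K → volume K = 0 → ∫ x in K, x ^ 2 ∂μ = 0 := by
    intro K hK hK0
    obtain ⟨R, hR0, hR⟩ := hK.isBounded.subset_ball_lt 0 0
    refine le_antisymm (le_of_forall_pos_le_add fun ε hε => ?_)
      (integral_nonneg fun x => sq_nonneg x)
    rw [zero_add]
    -- Chosen so that `C * R * δ ≤ ε`; the `+ 1` avoids division by zero.
    set δ : ℝ := ε / (C * R + 1) with hδ
    have hδ0 : 0 < δ := by positivity
    obtain ⟨V, hKV, hVo, hV⟩ := K.exists_isOpen_lt_of_lt (μ := volume) (ENNReal.ofReal δ)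
      (by rw [hK0]; simpa using hδ0)
    set U := V ∩ Metric.ball 0 R with hU
    have hUo : IsOpen U := hVo.inter Metric.isOpen_ball
    have hUr : volume.real U ≤ δ := by
      refine ENNReal.toReal_le_of_le_ofReal hδ0.le ?_
      exact (measure_mono Set.inter_subset_left).trans hV.le
    have hUf : volume U ≠ ⊤ := ((measure_mono Set.inter_subset_left).trans_lt
      (hV.trans ENNReal.ofReal_lt_top)).ne
    obtain ⟨χ, hχs, hχr, hχsupp, hχ1⟩ := exists_contMDiff_support_eq_eq_one_iff 𝓘(ℝ, ℝ) (n := ⊤)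
      hUo hK.isClosed (Set.subset_inter hKV hR)
    have hχ01 : ∀ x, 0 ≤ χ x ∧ χ x ≤ 1 := fun x => hχr (Set.mem_range_self x)
    have hχc : HasCompactSupport χ := by
      refine HasCompactSupport.intro' (isCompact_closedBall (0 : ℝ) R) Metric.isClosed_closedBall
        fun x hx => ?_
      by_contra hne
      have : x ∈ U := hχsupp ▸ hne
      exact hx (Metric.ball_subset_closedBall this.2)
    have hχd : ContDiff ℝ ∞ χ := hχs.contDiff
    have hfc : HasCompactSupport (fun x : ℝ => ((x * χ x : ℝ) : ℂ)) := by
      refine hχc.mono fun x hx => ?_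
      rw [Function.mem_support] at hx ⊢
      rintro h0
      simp [h0] at hx
    have hfd : ContDiff ℝ ∞ (fun x : ℝ => ((x * χ x : ℝ) : ℂ)) :=
      Complex.ofRealCLM.contDiff.comp (contDiff_id.mul hχd)
    -- The extra factor `x` turns the signed weight `x` into `x ^ 2 ≥ 0`, so the bound controls a
    -- positive integral.
    set F : SchwartzMap ℝ ℂ := hfc.toSchwartzMap hfd
    have hFa : ∀ x, F x = ((x * χ x : ℝ) : ℂ) := fun x => rfl
    have hmain := norm_integral_mul_schwartz_le hderiv hint F
    have hFn : ∀ x, ‖F x‖ ≤ U.indicator (fun _ => R) x := by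
      intro x
      rw [hFa, Complex.norm_real, Real.norm_eq_abs, abs_mul, abs_of_nonneg (hχ01 x).1]
      by_cases hx : x ∈ U
      · rw [Set.indicator_of_mem hx]
        have h1 : |x| < R := by simpa using hx.2
        nlinarith [abs_nonneg x, hχ01 x]
      · have : χ x = 0 := by
          by_contra hne
          exact hx (hχsupp ▸ hne)
        simp [this, hx]
    have hFi : ∫ x, ‖F x‖ ≤ R * δ := by
      calc ∫ x, ‖F x‖ ≤ ∫ x, U.indicator (fun _ => R) x :=
            integral_mono F.integrable.norm
              ((integrable_indicator_iff hUo.measurableSet).2 (integrableOn_const hUf)) hFn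
        _ = volume.real U * R := by
            rw [integral_indicator hUo.measurableSet, setIntegral_const, smul_eq_mul]
        _ ≤ R * δ := by nlinarith
    have hint2 : Integrable (fun x => x ^ 2 * χ x) μ :=
      Continuous.integrable_of_hasCompactSupport (f := fun x => x ^ 2 * χ x)
        ((continuous_pow 2).mul hχd.continuous) (hχc.mono fun x hx => by
          rw [Function.mem_support] at hx ⊢
          rintro h0
          simp [h0] at hx)
    have heq : ∫ x, (x : ℂ) * F x ∂μ = ((∫ x, x ^ 2 * χ x ∂μ : ℝ) : ℂ) := by
      rw [← integral_complex_ofReal]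
      refine integral_congr_ae (ae_of_all _ fun x => ?_)
      simp only [hFa]
      push_cast
      ring
    rw [heq, Complex.norm_real] at hmain
    calc ∫ x in K, x ^ 2 ∂μ = ∫ x in K, x ^ 2 * χ x ∂μ := by
          refine setIntegral_congr_fun hK.measurableSet fun x hx => ?_
          simp [(hχ1 x).1 hx]
      _ ≤ ∫ x, x ^ 2 * χ x ∂μ := setIntegral_le_integral hint2
          (ae_of_all _ fun x => mul_nonneg (sq_nonneg x) (hχ01 x).1)
      _ ≤ C * (R * δ) := (le_abs_self _).trans (hmain.trans (mul_le_mul_of_nonneg_left hFi hC))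
      _ ≤ ε := by
          have : (C * R + 1) * δ = ε := by rw [hδ]; field_simp
          nlinarith
  refine Measure.AbsolutelyContinuous.mk fun A hA hA0 => ?_
  -- Inner regularity reduces to compact null sets, where `x ^ 2` vanishes only at `0`.
  rw [hA.measure_eq_iSup_isCompact]
  simp only [ENNReal.iSup_eq_zero]
  intro K hKA hK
  have hk := key K hK (measure_mono_null hKA hA0)
  have hi : IntegrableOn (fun x : ℝ => x ^ 2) K μ :=
    (continuous_pow 2).continuousOn.integrableOn_compact hK
  rw [integral_eq_zero_iff_of_nonneg (fun x => sq_nonneg x) hi] at hk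
  have hk' : μ ({x : ℝ | ¬ x ^ 2 = 0} ∩ K) = 0 := by
    rwa [Filter.EventuallyEq, ae_iff, Measure.restrict_apply' hK.measurableSet] at hk
  refine measure_mono_null (t := ({x : ℝ | ¬ x ^ 2 = 0} ∩ K) ∪ {0}) (fun x hx => ?_)
    (measure_union_null hk' (measure_singleton_zero_of_tendsto_charFun htop hbot))
  by_cases h0 : x = 0
  · exact Or.inr h0
  · exact Or.inl ⟨by simpa using h0, hx⟩

/-! ### Estimates for the Linnik characteristic function. -/

theorem one_le_re_one_add_mul_ofReal {c : ℂ} (hc : 0 ≤ c.re) {t : ℝ} (ht : 0 ≤ t) :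
    1 ≤ (1 + c * (t : ℂ)).re := by
  simpa using mul_nonneg hc ht

/-- Averaging the lower bounds `1` and `‖c‖ * t` gives a minorant that is smooth in `t`, so its
powers can be differentiated. -/
theorem one_add_norm_mul_div_two_le_norm {c : ℂ} (hc : 0 ≤ c.re) {t : ℝ} (ht : 0 ≤ t) :
    (1 + ‖c‖ * t) / 2 ≤ ‖1 + c * (t : ℂ)‖ := by
  have h1 : 1 ≤ ‖1 + c * (t : ℂ)‖ :=
    (one_le_re_one_add_mul_ofReal hc ht).trans (Complex.re_le_norm _)
  have h2 : ‖c‖ * t ≤ ‖1 + c * (t : ℂ)‖ := by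
    refine le_of_sq_le_sq ?_ (norm_nonneg _)
    rw [mul_pow, Complex.sq_norm, Complex.sq_norm, Complex.normSq_apply, Complex.normSq_apply]
    simp only [Complex.add_re, Complex.one_re, Complex.mul_re, Complex.ofReal_re,
      Complex.ofReal_im, Complex.add_im, Complex.one_im, Complex.mul_im]
    nlinarith [mul_nonneg hc ht]
  linarith

/-- The derivative of `u ↦ (1 + c u ^ α) ^ (-ν)` on the positive half-line. -/
noncomputable def halfLinnikDeriv (α ν : ℝ) (c : ℂ) (u : ℝ) : ℂ :=
  ((-ν : ℝ) : ℂ) * (1 + c * ((u ^ α : ℝ) : ℂ)) ^ (((-ν - 1 : ℝ)) : ℂ) *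
    (c * ((α * u ^ (α - 1) : ℝ) : ℂ))

theorem hasDerivAt_one_add_mul_rpow_cpow (α ν : ℝ) {c : ℂ} (hc : 0 ≤ c.re) {u : ℝ} (hu : 0 < u) :
    HasDerivAt (fun u : ℝ => (1 + c * ((u ^ α : ℝ) : ℂ)) ^ ((-ν : ℝ) : ℂ))
      (halfLinnikDeriv α ν c u) u := by
  have h1 : HasDerivAt (fun u : ℝ => 1 + c * ((u ^ α : ℝ) : ℂ))
      (c * ((α * u ^ (α - 1) : ℝ) : ℂ)) u :=
    ((Real.hasDerivAt_rpow_const (p := α) (Or.inl hu.ne')).ofReal_comp.const_mul c).const_add 1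
  have hs : 1 + c * ((u ^ α : ℝ) : ℂ) ∈ Complex.slitPlane :=
    Or.inl (zero_lt_one.trans_le (one_le_re_one_add_mul_ofReal hc (Real.rpow_nonneg hu.le α)))
  have h2 := ((hasDerivAt_id _).cpow_const (c := ((-ν : ℝ) : ℂ)) hs).comp u h1
  refine h2.congr_deriv ?_
  simp [halfLinnikDeriv]

theorem norm_one_add_mul_cpow_le {c : ℂ} (hc : 0 ≤ c.re) {t p : ℝ} (ht : 0 ≤ t) (hp : p ≤ 0) :
    ‖(1 + c * (t : ℂ)) ^ (p : ℂ)‖ ≤ ((1 + ‖c‖ * t) / 2) ^ p := by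
  have hne : (1 + c * (t : ℂ)) ≠ 0 := fun h0 => by
    have := one_le_re_one_add_mul_ofReal hc ht
    rw [h0] at this
    norm_num at this
  rw [Complex.norm_cpow_of_ne_zero hne]
  simp only [Complex.ofReal_re, Complex.ofReal_im, mul_zero, Real.exp_zero, div_one]
  exact Real.rpow_le_rpow_of_nonpos (by positivity) (one_add_norm_mul_div_two_le_norm hc ht) hp

open Filter Topology in
theorem tendsto_one_add_mul_rpow_div_two_rpow_neg {α ν a : ℝ} (hα : 0 < α) (hν : 0 < ν)
    (ha : 0 < a) : Tendsto (fun u : ℝ => ((1 + a * u ^ α) / 2) ^ (-ν)) atTop (𝓝 0) :=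
  (tendsto_rpow_neg_atTop hν).comp
    ((tendsto_atTop_add_const_left _ 1 ((tendsto_rpow_atTop hα).const_mul_atTop ha)).atTop_div_const
      two_pos)

open Filter Topology in
theorem tendsto_one_add_mul_rpow_cpow_neg {α ν : ℝ} {c : ℂ} (hα : 0 < α) (hν : 0 < ν)
    (hc : 0 ≤ c.re) (hc0 : c ≠ 0) :
    Tendsto (fun u : ℝ => (1 + c * ((u ^ α : ℝ) : ℂ)) ^ ((-ν : ℝ) : ℂ)) atTop (𝓝 0) := by
  refine squeeze_zero_norm' ?_
    (tendsto_one_add_mul_rpow_div_two_rpow_neg hα hν (norm_pos_iff.2 hc0))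
  filter_upwards [eventually_ge_atTop 0] with u hu
  exact norm_one_add_mul_cpow_le hc (Real.rpow_nonneg hu α) (by linarith)

open Set in
theorem integrableOn_halfLinnikDeriv {α ν : ℝ} {c : ℂ} (hα : 0 < α) (hν : 0 < ν)
    (hc : 0 ≤ c.re) (hc0 : c ≠ 0) : IntegrableOn (halfLinnikDeriv α ν c) (Ioi 0) := by
  have ha : 0 < ‖c‖ := norm_pos_iff.2 hc0
  -- Derivative of `((1 + ‖c‖ * u ^ α) / 2) ^ (-ν)`, which decreases to `0`; hence it is integrable
  -- even where `u ^ (α - 1)` blows up at `0`.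
  set g' : ℝ → ℝ := fun u =>
    ‖c‖ * (α * u ^ (α - 1)) / 2 * (-ν) * ((1 + ‖c‖ * u ^ α) / 2) ^ (-ν - 1) with hg'
  have hpos : ∀ u ∈ Ioi (0 : ℝ), 0 < (1 + ‖c‖ * u ^ α) / 2 := fun u hu => by
    have := Real.rpow_nonneg (le_of_lt (mem_Ioi.1 hu)) α
    positivity
  have hg : IntegrableOn g' (Ioi 0) := by
    refine integrableOn_Ioi_deriv_of_nonpos (l := 0)
      (g := fun u => ((1 + ‖c‖ * u ^ α) / 2) ^ (-ν)) ?_ ?_ ?_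
      (tendsto_one_add_mul_rpow_div_two_rpow_neg hα hν ha)
    · refine ContinuousAt.continuousWithinAt ?_
      refine ContinuousAt.rpow_const ?_ (Or.inl (by simp [hα.ne']))
      exact ((continuousAt_const.mul (Real.continuousAt_rpow_const _ _ (Or.inr hα.le))).const_add 1
        ).div_const 2
    · intro u hu
      exact ((((Real.hasDerivAt_rpow_const (p := α) (Or.inl (ne_of_gt hu))).const_mul
        ‖c‖).const_add 1).div_const 2).rpow_const (Or.inl (hpos u hu).ne')
    · intro u hu
      have h1 := Real.rpow_nonneg (hpos u hu).le (-ν - 1)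
      have h2 := Real.rpow_nonneg (le_of_lt (mem_Ioi.1 hu)) (α - 1)
      have : 0 ≤ ‖c‖ * (α * u ^ (α - 1)) / 2 * ν * ((1 + ‖c‖ * u ^ α) / 2) ^ (-ν - 1) := by
        positivity
      rw [hg']
      linarith
  -- The factor `2` undoes the halving in the base of the majorant.
  refine Integrable.mono' (hg.norm.const_mul 2) ?_ ?_
  · unfold halfLinnikDeriv
    fun_prop
  · refine (ae_restrict_iff' measurableSet_Ioi).2 (ae_of_all _ fun u hu => ?_)
    have hu0 : 0 ≤ u := le_of_lt (mem_Ioi.1 hu)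
    have h1 := norm_one_add_mul_cpow_le hc (Real.rpow_nonneg hu0 α) (p := -ν - 1) (by linarith)
    have h2 := Real.rpow_nonneg hu0 (α - 1)
    have h3 := Real.rpow_nonneg (hpos u hu).le (-ν - 1)
    have h4 : 0 ≤ α * u ^ (α - 1) := by positivity
    simp only [halfLinnikDeriv, norm_mul, Complex.norm_real, hg', norm_neg, norm_div,
      Real.norm_of_nonneg hν.le, Real.norm_of_nonneg h4, Real.norm_of_nonneg h3, norm_norm,
      Real.norm_ofNat]
    calc _ ≤ ν * ((1 + ‖c‖ * u ^ α) / 2) ^ (-ν - 1) * (‖c‖ * (α * u ^ (α - 1))) := by gcongr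
      _ = _ := by ring

theorem linnikCF_of_pos {α θ lam ν u : ℝ} (hu : 0 < u) :
    linnikCF α θ lam ν u =
      (1 + lam * Complex.exp (-Complex.I * θ) * ((u ^ α : ℝ) : ℂ)) ^ ((-ν : ℝ) : ℂ) := by
  rw [linnikCF, abs_of_pos hu, Real.sign_of_pos hu, Complex.ofReal_neg, Complex.cpow_neg, one_div]
  push_cast
  ring_nf

theorem linnikCF_of_neg {α θ lam ν u : ℝ} (hu : u < 0) :
    linnikCF α θ lam ν u =
      (1 + lam * Complex.exp (Complex.I * θ) * (((-u) ^ α : ℝ) : ℂ)) ^ ((-ν : ℝ) : ℂ) := by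
  rw [linnikCF, abs_of_neg hu, Real.sign_of_neg hu, Complex.ofReal_neg ν, Complex.cpow_neg, one_div]
  push_cast
  ring_nf

theorem re_ofReal_mul_exp_I_mul_nonneg {lam θ : ℝ} (hlam : 0 < lam) (hθ : |θ| ≤ Real.pi / 2) :
    0 ≤ ((lam : ℂ) * Complex.exp (Complex.I * θ)).re := by
  rw [Complex.re_ofReal_mul, mul_comm Complex.I, Complex.exp_ofReal_mul_I_re]
  have := abs_le.1 hθ
  exact mul_nonneg hlam.le (Real.cos_nonneg_of_neg_pi_div_two_le_of_le (by linarith) this.2)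

open Filter Topology Set in
/-- A generalized Linnik law `GL(α, θ, ν)` with `|θ| ≤ π / 2` is absolutely continuous. -/
theorem IsGeneralizedLinnik.absolutelyContinuous {α θ lam ν : ℝ} {μ : Measure ℝ} (hα : 0 < α)
    (hlam : 0 < lam) (hν : 0 < ν) (hθ : |θ| ≤ Real.pi / 2)
    (hμ : IsGeneralizedLinnik α θ lam ν μ) : μ ≪ volume := by
  have := hμ.isProbabilityMeasure
  set c₁ : ℂ := lam * Complex.exp (-Complex.I * θ) with hc₁
  set c₂ : ℂ := lam * Complex.exp (Complex.I * θ) with hc₂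
  have hl : (lam : ℂ) ≠ 0 := by exact_mod_cast hlam.ne'
  have h₁0 : c₁ ≠ 0 := mul_ne_zero hl (Complex.exp_ne_zero _)
  have h₂0 : c₂ ≠ 0 := mul_ne_zero hl (Complex.exp_ne_zero _)
  have h₂ : 0 ≤ c₂.re := re_ofReal_mul_exp_I_mul_nonneg hlam hθ
  have h₁ : 0 ≤ c₁.re := by
    have := re_ofReal_mul_exp_I_mul_nonneg (θ := -θ) hlam (by rwa [abs_neg])
    simpa [hc₁] using this
  have hpos : ∀ u : ℝ, 0 < u →
      charFun μ u = (1 + c₁ * ((u ^ α : ℝ) : ℂ)) ^ ((-ν : ℝ) : ℂ) :=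
    fun u hu => (hμ.charFun_eq u).trans (linnikCF_of_pos hu)
  have hneg : ∀ u : ℝ, u < 0 →
      charFun μ u = (1 + c₂ * (((-u) ^ α : ℝ) : ℂ)) ^ ((-ν : ℝ) : ℂ) :=
    fun u hu => (hμ.charFun_eq u).trans (linnikCF_of_neg hu)
  refine absolutelyContinuous_of_integrable_deriv_charFun
    (φ' := fun u => (Ioi (0 : ℝ)).indicator (halfLinnikDeriv α ν c₁) u -
      (Ioi (0 : ℝ)).indicator (halfLinnikDeriv α ν c₂) (-u)) (fun u hu => ?_) ?_ ?_ ?_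
  · rcases lt_or_gt_of_ne hu with hu | hu
    · have h := (hasDerivAt_one_add_mul_rpow_cpow α ν h₂ (neg_pos.2 hu)).scomp u (hasDerivAt_neg u)
      simp only [mem_Ioi, not_lt.2 hu.le, not_false_eq_true, indicator_of_notMem, zero_sub,
        neg_pos.2 hu, indicator_of_mem]
      refine (h.congr_of_eventuallyEq ?_).congr_deriv (by simp)
      filter_upwards [Iio_mem_nhds hu] with v hv using hneg v hv
    · have h := hasDerivAt_one_add_mul_rpow_cpow α ν h₁ hu
      have hu' : ¬ 0 < -u := by linarith
      simp only [mem_Ioi, hu, indicator_of_mem, hu', not_false_eq_true, indicator_of_notMem,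
        sub_zero]
      refine h.congr_of_eventuallyEq ?_
      filter_upwards [Ioi_mem_nhds hu] with v hv using hpos v hv
  · exact ((integrable_indicator_iff measurableSet_Ioi).2
      (integrableOn_halfLinnikDeriv hα hν h₁ h₁0)).sub
      ((integrable_indicator_iff measurableSet_Ioi).2
      (integrableOn_halfLinnikDeriv hα hν h₂ h₂0)).comp_neg
  · refine (tendsto_one_add_mul_rpow_cpow_neg hα hν h₁ h₁0).congr' ?_
    filter_upwards [eventually_gt_atTop 0] with u hu using (hpos u hu).symm
  · refine ((tendsto_one_add_mul_rpow_cpow_neg hα hν h₂ h₂0).comp tendsto_neg_atBot_atTop).congr' ?_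
    filter_upwards [eventually_lt_atBot 0] with u hu using (hneg u hu).symm

theorem theorem2p5 (α θ lam : ℝ) (k : ℕ)
    (hα0 : 0 < α) (hα2 : α ≤ 2) (hlam : 0 < lam) (hk : 0 < k)
    (hθ : |θ| ≤ min (Real.pi * α / 2) (Real.pi - Real.pi * α / 2))
    (μ : Measure ℝ) (hμ : IsGeneralizedLinnik α θ lam (1 / (k : ℝ)) μ) :
    μ ≪ (volume : Measure ℝ) := by
  have h := le_min_iff.1 hθ
  -- The two bounds on `|θ|` add up to `π`, so `|θ| ≤ π / 2`.
  exact hμ.absolutelyContinuous hα0 hlam (by positivity) (by linarith [h.1, h.2])
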